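/- Let $n\ge 0$, let $\mathfrak g=gl(n)$ be the Lie algebra of complex $n\times n$ matrices with the commutator bracket, and let $\mathfrak g[t]=\mathfrak g\otimes_{\mathbb C}\mathbb C[t]$ be the Lie algebra with bracket $[x(P),y(Q)]=[x,y](PQ)$, where $x(P)=x\otimes P$ for $x\in\mathfrak g$, $P\in\mathbb C[t]$. Let $U(\mathfrak g[t])$ be its universal enveloping algebra over $\mathbb C$, and let $[U(\mathfrak g[t])]^{\mathfrak g}$ be the subalgebra of those $u\in U(\mathfrak g[t])$ with $x(1)\,u-u\,x(1)=0$ for all $x\in\mathfrak g$. Let $E_{i,j}$ be the $n\times n$ matrix whose $(i,j)$-th entry is $1$ and whose other entries are $0$, and put $E_{i,j}(m)=E_{i,j}(t^m)$ for $m\ge 0$. Then $[U(\mathfrak g[t])]^{\mathfrak g}$ is precisely the $\mathbb C$-linear span of $$\bigcup_{k\ge 0}\ \bigcup_{0\le n_1\le\dots\le n_k}\Big\{\sum_{1\le i_1,\dots,i_k\le n}E_{i_1,i_{\sigma(1)}}(n_1)\cdots E_{i_k,i_{\sigma(k)}}(n_k)\ :\ \sigma\in\Sigma_k\Big\},$$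 where $n_1,\dots,n_k$ are integers, $\Sigma_k$ is the symmetric group on $\{1,\dots,k\}$, and for $k=0$ the only element is $1$. -/

import Mathlib

open scoped TensorProduct

noncomputable section

section Current

attribute [local instance 100] LieRing.ofAssociativeRing

/-- The current algebra `𝔤[t] = ℂ[t] ⊗ 𝔤`, with `[P ⊗ x, Q ⊗ y] = PQ ⊗ [x, y]`. -/
abbrev CurrentAlgebra (𝔤 : Type*) [LieRing 𝔤] [LieAlgebra ℂ 𝔤] : Type _ :=
  Polynomial ℂ ⊗[ℂ] 𝔤

/-- The enveloping algebra `U(𝔤[t])` over `ℂ`. -/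
abbrev UCurrent (𝔤 : Type*) [LieRing 𝔤] [LieAlgebra ℂ 𝔤] : Type _ :=
  UniversalEnvelopingAlgebra ℂ (CurrentAlgebra 𝔤)

/-- The image in `U(𝔤[t])` of `x(P) = P ⊗ x`. -/
def currentElt {𝔤 : Type*} [LieRing 𝔤] [LieAlgebra ℂ 𝔤] (x : 𝔤) (P : Polynomial ℂ) :
    UCurrent 𝔤 :=
  UniversalEnvelopingAlgebra.ι ℂ (P ⊗ₜ[ℂ] x : CurrentAlgebra 𝔤)

/-- The subalgebra `[U(𝔤[t])]^𝔤` of invariants for the adjoint action of `𝔤` (embedded in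
`𝔤[t]` as the constants `x(1)`) on `U(𝔤[t])`, namely `x · u = [x(1), u] = x(1) u - u x(1)`. -/
def currentInvariants (𝔤 : Type*) [LieRing 𝔤] [LieAlgebra ℂ 𝔤] :
    Subalgebra ℂ (UCurrent 𝔤) where
  carrier := {u | ∀ x : 𝔤, currentElt x 1 * u - u * currentElt x 1 = 0}
  mul_mem' := by
    intro a b ha hb x
    have h1 := sub_eq_zero.mp (ha x)
    have h2 := sub_eq_zero.mp (hb x)
    rw [← mul_assoc, h1, mul_assoc, h2, mul_assoc, sub_self]
  add_mem' := by
    intro a b ha hb x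
    have h1 := sub_eq_zero.mp (ha x)
    have h2 := sub_eq_zero.mp (hb x)
    rw [mul_add, add_mul, h1, h2, sub_self]
  algebraMap_mem' := by
    intro r x
    rw [Algebra.commutes, sub_self]

end Current

/-- The Lie algebra `gl(n)` of all complex `n × n` matrices. -/
abbrev GlLie (n : ℕ) : Type := Matrix (Fin n) (Fin n) ℂ

/-- The bracket on `gl(n)` is the commutator `[x, y] = x y - y x`. -/
instance instLieRingGlLie (n : ℕ) : LieRing (GlLie n) := LieRing.ofAssociativeRing

/-- The complex Lie algebra structure on `gl(n)`. -/
instance instLieAlgebraGlLie (n : ℕ) : LieAlgebra ℂ (GlLie n) := LieAlgebra.ofAssociativeAlgebra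

/-- The element `∑_{1 ≤ i_1, …, i_k ≤ n} E_{i_1, i_{σ(1)}}(m_1) ⋯ E_{i_k, i_{σ(k)}}(m_k)` of
`U(gl(n)[t])`, where `x(m)` is `x(t^m)`. The product is ordered from left to right. -/
def permInvariant (n : ℕ) {k : ℕ} (σ : Equiv.Perm (Fin k)) (m : Fin k → ℕ) :
    UCurrent (GlLie n) :=
  ∑ i : Fin k → Fin n,
    (List.ofFn fun j : Fin k =>
      currentElt (Matrix.single (i j) (i (σ j)) (1 : ℂ) : GlLie n)
        (Polynomial.X ^ m j)).prod

end

/-!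
The elements `permInvariant n σ m` are images of permutations of the tensor factors of
`V^{⊗k}`, where `V = ℂⁿ`. A matrix on `V^{⊗k}` is a tensor in `𝔤^{⊗k}` for `𝔤 = gl(n)`, and for
exponents `m₁, …, mₖ` the linear map `evalTensor` sends `x₁ ⊗ ⋯ ⊗ xₖ` to
`x₁(t ^ m₁) ⋯ xₖ(t ^ mₖ)`. It is equivariant (`currentElt_commutator_evalTensor`): `𝔤` acts on the
source by commutators with `diagAction k x`, and on the enveloping algebra by commutators with
`x(1)`. A permutation commutes with `diagAction k x`, so its image is invariant.

Conversely, the ranges of the maps `evalTensor` with weakly increasing exponents together span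
`U(𝔤[t])`, by the spanning half of the Poincaré–Birkhoff–Witt theorem (`sortedSpan_eq_top`). So an
invariant `u` is the image of a vector in a finite product of matrix spaces that is invariant modulo
the kernel. For the Hermitian trace form the adjoint of `[diagAction k x, ·]` is
`[diagAction k xᴴ, ·]`; hence the orthogonal complement of the kernel is stable, and `u` lifts to a
vector that is truly invariant (`exists_sub_mem_forall_commute`). Its components commute with all
`diagAction k x`, and Schur–Weyl duality (`mem_span_permTensorMatrix`) says that such matrices are
linear combinations of permutations.

For Schur–Weyl duality, let `X` commute with all `diagAction k x`. These operators generate all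
symmetric matrices (`diagAction_mul_placementSum`), so `X` commutes with every symmetric matrix.
Averaging over the symmetric group turns any projection onto the span of the permutations into a map
`p` that commutes with left multiplication by permutations, and is a multiple of a projection. Then
`p` is made of symmetric matrices, so it commutes with left multiplication by `X`, and
`p X = X * p 1` is a nonzero multiple of `X`.
-/

noncomputable section

/-! ### Tensor powers of matrices -/

/-- The matrix of `f 0 ⊗ ⋯ ⊗ f (k - 1)` acting on the `k`-th tensor power of `ℂⁿ`, whose standard
basis is indexed by the words `Fin k → Fin n`. -/
def tensorMatrix {n k : ℕ} (f : Fin k → Matrix (Fin n) (Fin n) ℂ) :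
    Matrix (Fin k → Fin n) (Fin k → Fin n) ℂ :=
  Matrix.of fun i j => ∏ l, f l (i l) (j l)

/-- The matrix of `x` acting on the `k`-th tensor power of `ℂⁿ` as a Lie algebra element, that is
`∑ l, 1 ⊗ ⋯ ⊗ x ⊗ ⋯ ⊗ 1` with `x` in position `l`. -/
def diagAction (k : ℕ) {n : ℕ} (x : Matrix (Fin n) (Fin n) ℂ) :
    Matrix (Fin k → Fin n) (Fin k → Fin n) ℂ :=
  ∑ l : Fin k, tensorMatrix (Pi.mulSingle l x)

section TensorMatrix

variable {n k : ℕ}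

lemma tensorMatrix_mul (f g : Fin k → Matrix (Fin n) (Fin n) ℂ) :
    tensorMatrix f * tensorMatrix g = tensorMatrix (f * g) := by
  ext i j
  simp only [tensorMatrix, Matrix.mul_apply, Matrix.of_apply, Pi.mul_apply,
    Finset.prod_univ_sum, Fintype.piFinset_univ, Finset.prod_mul_distrib]

lemma tensorMatrix_conjTranspose (f : Fin k → Matrix (Fin n) (Fin n) ℂ) :
    (tensorMatrix f).conjTranspose = tensorMatrix fun l => (f l).conjTranspose := by
  ext i j
  simp [tensorMatrix, Matrix.conjTranspose_apply]

lemma tensorMatrix_single (i j : Fin k → Fin n) :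
    tensorMatrix (fun l => Matrix.single (i l) (j l) (1 : ℂ)) = Matrix.single i j 1 := by
  ext a b
  simp only [tensorMatrix, Matrix.of_apply, Matrix.single_apply, funext_iff, ← forall_and]
  rw [Finset.prod_ite_zero]
  simp

lemma diagAction_conjTranspose (x : Matrix (Fin n) (Fin n) ℂ) :
    (diagAction k x).conjTranspose = diagAction k x.conjTranspose := by
  simp only [diagAction, Matrix.conjTranspose_sum, tensorMatrix_conjTranspose]
  refine Finset.sum_congr rfl fun l _ => congrArg _ (funext fun j => ?_)
  exact Pi.apply_mulSingle (fun _ => Matrix.conjTranspose)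
    (fun _ => Matrix.conjTranspose_one) l x j

lemma mulSingle_mul_eq_update (f : Fin k → Matrix (Fin n) (Fin n) ℂ) (l : Fin k)
    (x : Matrix (Fin n) (Fin n) ℂ) :
    Pi.mulSingle l x * f = Function.update f l (x * f l) := by
  ext1 j
  rcases eq_or_ne j l with rfl | h <;> simp [*]

lemma mul_mulSingle_eq_update (f : Fin k → Matrix (Fin n) (Fin n) ℂ) (l : Fin k)
    (x : Matrix (Fin n) (Fin n) ℂ) :
    f * Pi.mulSingle l x = Function.update f l (f l * x) := by
  ext1 j
  rcases eq_or_ne j l with rfl | h <;> simp [*]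

lemma diagAction_commutator_tensorMatrix (x : Matrix (Fin n) (Fin n) ℂ)
    (f : Fin k → Matrix (Fin n) (Fin n) ℂ) :
    diagAction k x * tensorMatrix f - tensorMatrix f * diagAction k x =
      ∑ l, (tensorMatrix (Function.update f l (x * f l)) -
        tensorMatrix (Function.update f l (f l * x))) := by
  simp only [diagAction, Finset.sum_mul, Finset.mul_sum, tensorMatrix_mul,
    mulSingle_mul_eq_update, mul_mulSingle_eq_update, Finset.sum_sub_distrib]

end TensorMatrix

/-! ### Symmetric tensors -/

/-- The sum, over all ways of putting `x 0, …, x (r - 1)` in distinct positions, of the tensor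
product of the `x a` in their positions with identity matrices elsewhere. -/
def placementSum (k : ℕ) {n r : ℕ} (x : Fin r → Matrix (Fin n) (Fin n) ℂ) :
    Matrix (Fin k → Fin n) (Fin k → Fin n) ℂ :=
  ∑ e : Fin r ↪ Fin k, tensorMatrix (Function.extend e x 1)

section Symmetric

variable {n k : ℕ}

/-- Left multiplication by `y` in one position either fills an empty position or multiplies one of
the matrices already placed. -/
lemma diagAction_mul_placementSum {r : ℕ} (y : Matrix (Fin n) (Fin n) ℂ)
    (x : Fin r → Matrix (Fin n) (Fin n) ℂ) :
    diagAction k y * placementSum k x =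
      placementSum k (Fin.cons y x : Fin (r + 1) → Matrix (Fin n) (Fin n) ℂ) +
        ∑ a, placementSum k (Function.update x a (y * x a)) := by
  classical
  have hsplit : ∀ e : Fin r ↪ Fin k,
      ∑ l, tensorMatrix (Pi.mulSingle l y * Function.extend e x 1) =
        (∑ l : {l // l ∉ Set.range e}, tensorMatrix (Pi.mulSingle l.1 y * Function.extend e x 1)) +
          ∑ a, tensorMatrix (Function.extend e (Function.update x a (y * x a)) 1) := by
    intro e
    rw [← Fintype.sum_subtype_add_sum_subtype (fun l => l ∉ Set.range e)]
    congr 1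
    have key : ∀ a, Pi.mulSingle (e a) y * Function.extend e x 1 =
        Function.extend e (Function.update x a (y * x a)) 1 := by
      intro a
      rw [mulSingle_mul_eq_update, e.injective.extend_apply]
      ext1 l
      by_cases hl : ∃ b, e b = l
      · obtain ⟨b, rfl⟩ := hl
        rw [e.injective.extend_apply]
        rcases eq_or_ne b a with rfl | hb
        · simp
        · rw [Function.update_of_ne (e.injective.ne hb), Function.update_of_ne hb,
            e.injective.extend_apply]
      · have hla : l ≠ e a := fun h => hl ⟨a, h.symm⟩
        rw [Function.update_of_ne hla, Function.extend_apply' _ _ _ hl,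
          Function.extend_apply' _ _ _ hl]
    let g : Fin r ≃ {l // ¬ l ∉ Set.range e} :=
      (Equiv.ofInjective e e.injective).trans (Equiv.subtypeEquivRight fun _ => not_not.symm)
    rw [← Equiv.sum_comp g]
    exact Finset.sum_congr rfl fun a _ => congrArg _ (key a)
  have hcons : placementSum k (Fin.cons y x : Fin (r + 1) → Matrix (Fin n) (Fin n) ℂ) =
      ∑ e : Fin r ↪ Fin k, ∑ l : {l // l ∉ Set.range e},
        tensorMatrix (Pi.mulSingle l.1 y * Function.extend e x 1) := by
    rw [placementSum, ← Equiv.sum_comp (Equiv.embeddingFinSucc r (Fin k)).symm,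
      Fintype.sum_sigma]
    refine Finset.sum_congr rfl fun e _ => Finset.sum_congr rfl fun l _ => congrArg _ ?_
    set e' := (Equiv.embeddingFinSucc r (Fin k)).symm ⟨e, l⟩ with he'
    have h0 : e' 0 = l.1 := by simp [he']
    have hs : ∀ a, e' (Fin.succ a) = e a := fun a => by simp [he']
    ext1 p
    by_cases hp : ∃ b, e' b = p
    · obtain ⟨b, rfl⟩ := hp
      rw [e'.injective.extend_apply, Pi.mul_apply]
      refine Fin.cases ?_ (fun a => ?_) b
      · rw [h0, Function.extend_apply' _ _ _ (fun h => l.2 h)]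
        simp
      · have hne : e a ≠ l.1 := fun h => l.2 ⟨a, h⟩
        rw [hs, e.injective.extend_apply, Pi.mulSingle_eq_of_ne hne]
        simp
    · rw [Function.extend_apply' _ _ _ hp, Pi.mul_apply,
        Function.extend_apply' _ _ _ (fun ⟨a, ha⟩ => hp ⟨a.succ, (hs a).trans ha⟩),
        Pi.mulSingle_eq_of_ne (fun h => hp ⟨0, h0.trans h.symm⟩)]
      simp
  rw [hcons]
  simp only [placementSum, diagAction, Finset.sum_mul, Finset.mul_sum, tensorMatrix_mul]
  rw [Finset.sum_comm (γ := Fin r), ← Finset.sum_add_distrib]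
  exact Finset.sum_congr rfl fun e _ => hsplit e

lemma commute_placementSum {X : Matrix (Fin k → Fin n) (Fin k → Fin n) ℂ}
    (hX : ∀ x : Matrix (Fin n) (Fin n) ℂ, Commute X (diagAction k x)) :
    ∀ (r : ℕ) (x : Fin r → Matrix (Fin n) (Fin n) ℂ), Commute X (placementSum k x) := by
  intro r
  induction r with
  | zero =>
    intro x
    have h1 : ∀ e : Fin 0 ↪ Fin k,
        tensorMatrix (Function.extend e x 1) = (1 : Matrix (Fin k → Fin n) _ ℂ) := by
      intro e
      have : Function.extend e x 1 = 1 :=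
        funext fun l => Function.extend_apply' _ _ _ fun ⟨a, _⟩ => a.elim0
      rw [this]
      ext i j
      simp [tensorMatrix, Matrix.one_apply, Finset.prod_ite_zero, funext_iff]
    unfold placementSum
    exact Commute.sum_right _ _ _ fun e _ => by rw [h1]; exact Commute.one_right X
  | succ r ih =>
    intro x
    have h := diagAction_mul_placementSum (k := k) (x 0) (Fin.tail x)
    rw [Fin.cons_self_tail] at h
    rw [eq_sub_of_add_eq h.symm]
    exact ((hX _).mul_right (ih _)).sub_right
      (Commute.sum_right _ _ _ fun a _ => ih _)

lemma placementSum_self (x : Fin k → Matrix (Fin n) (Fin n) ℂ) :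
    placementSum k x = ∑ σ : Equiv.Perm (Fin k), tensorMatrix (x ∘ σ) := by
  rw [placementSum, ← Equiv.sum_comp (Equiv.inv (Equiv.Perm (Fin k))),
    ← Equiv.sum_comp (Equiv.embeddingEquivOfFinite (Fin k))]
  refine Finset.sum_congr rfl fun e _ => congrArg _ (funext fun l => ?_)
  obtain ⟨a, rfl⟩ := (Equiv.embeddingEquivOfFinite (Fin k) e).surjective l
  have : (Equiv.embeddingEquivOfFinite (Fin k) e) a = e a := rfl
  rw [Function.comp_apply, Equiv.inv_apply, Equiv.Perm.inv_def, Equiv.symm_apply_apply, this,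
    e.injective.extend_apply]

/-- A matrix commuting with the Lie algebra action on the tensor power commutes with every matrix
that is invariant under the simultaneous permutation of the tensor factors. -/
lemma commute_of_symmetric {X C : Matrix (Fin k → Fin n) (Fin k → Fin n) ℂ}
    (hX : ∀ x : Matrix (Fin n) (Fin n) ℂ, Commute X (diagAction k x))
    (hC : ∀ (σ : Equiv.Perm (Fin k)) i j, C (i ∘ σ) (j ∘ σ) = C i j) : Commute X C := by
  -- Symmetrize the expansion of `C` in matrix units; each orbit sum is a `placementSum`.
  have hsum : (Fintype.card (Equiv.Perm (Fin k)) : ℂ) • C =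
      ∑ i, ∑ j, C i j • ∑ σ : Equiv.Perm (Fin k),
        (Matrix.single (i ∘ σ) (j ∘ σ) (1 : ℂ)) := by
    have h : ∀ σ : Equiv.Perm (Fin k), C =
        ∑ i, ∑ j, C i j • Matrix.single (i ∘ σ) (j ∘ σ) (1 : ℂ) := by
      intro σ
      conv_lhs => rw [Matrix.matrix_eq_sum_single C]
      rw [← Equiv.sum_comp (σ.symm.arrowCongr (Equiv.refl (Fin n)))]
      refine Finset.sum_congr rfl fun i _ => ?_
      rw [← Equiv.sum_comp (σ.symm.arrowCongr (Equiv.refl (Fin n)))]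
      refine Finset.sum_congr rfl fun j _ => ?_
      have hc : ∀ i : Fin k → Fin n, (σ.symm.arrowCongr (Equiv.refl (Fin n))) i = i ∘ σ :=
        fun i => rfl
      rw [hc, hc, hC, Matrix.smul_single, smul_eq_mul, mul_one]
    rw [Nat.cast_smul_eq_nsmul, ← Finset.card_univ, ← Finset.sum_const,
      Finset.sum_congr rfl fun σ _ => h σ]
    simp only [Finset.smul_sum]
    rw [Finset.sum_comm]
    exact Finset.sum_congr rfl fun i _ => Finset.sum_comm
  have hcard : (Fintype.card (Equiv.Perm (Fin k)) : ℂ) ≠ 0 :=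
    Nat.cast_ne_zero.mpr Fintype.card_ne_zero
  rw [← inv_smul_smul₀ hcard C, hsum]
  refine Commute.smul_right (Commute.sum_right _ _ _ fun i _ => Commute.sum_right _ _ _ fun j _ =>
    Commute.smul_right ?_ _) _
  have := commute_placementSum hX k fun l => Matrix.single (i l) (j l) (1 : ℂ)
  rw [placementSum_self] at this
  have he : ∀ σ : Equiv.Perm (Fin k),
      tensorMatrix ((fun l => Matrix.single (i l) (j l) (1 : ℂ)) ∘ σ) =
        Matrix.single (i ∘ σ) (j ∘ σ) (1 : ℂ) := fun σ => tensorMatrix_single (i ∘ σ) (j ∘ σ)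
  simpa only [he] using this

end Symmetric

/-! ### Schur–Weyl duality -/

/-- The matrix permuting the tensor factors: its `(i, j)` entry is `1` if `j = i ∘ σ` and `0`
otherwise. -/
def permTensorMatrix (n : ℕ) {k : ℕ} (σ : Equiv.Perm (Fin k)) :
    Matrix (Fin k → Fin n) (Fin k → Fin n) ℂ :=
  Matrix.of fun i j => if j = i ∘ σ then 1 else 0

section SchurWeyl

variable {n k : ℕ}

lemma permTensorMatrix_mul_apply (σ : Equiv.Perm (Fin k))
    (Y : Matrix (Fin k → Fin n) (Fin k → Fin n) ℂ) (i j : Fin k → Fin n) :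
    (permTensorMatrix n σ * Y) i j = Y (i ∘ σ) j := by
  simp [permTensorMatrix, Matrix.mul_apply]

lemma permTensorMatrix_mul (σ τ : Equiv.Perm (Fin k)) :
    permTensorMatrix n σ * permTensorMatrix n τ = permTensorMatrix n (σ * τ) := by
  ext i j
  rw [permTensorMatrix_mul_apply]
  rfl

lemma permTensorMatrix_one : permTensorMatrix n (1 : Equiv.Perm (Fin k)) = 1 := by
  ext i j
  simp [permTensorMatrix, Matrix.one_apply, eq_comm]

lemma mul_permTensorMatrix_apply (σ : Equiv.Perm (Fin k))
    (Y : Matrix (Fin k → Fin n) (Fin k → Fin n) ℂ) (i j : Fin k → Fin n) :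
    (Y * permTensorMatrix n σ) i (j ∘ σ) = Y i j := by
  have h : ∀ l : Fin k → Fin n, j ∘ σ = l ∘ σ ↔ j = l :=
    fun l => σ.surjective.injective_comp_right.eq_iff
  simp [permTensorMatrix, Matrix.mul_apply, h]

lemma diagAction_comp_perm (x : Matrix (Fin n) (Fin n) ℂ) (σ : Equiv.Perm (Fin k))
    (i j : Fin k → Fin n) : diagAction k x (i ∘ σ) (j ∘ σ) = diagAction k x i j := by
  simp only [diagAction, Matrix.sum_apply]
  symm
  rw [← Equiv.sum_comp σ]
  refine Finset.sum_congr rfl fun l _ => ?_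
  simp only [tensorMatrix, Matrix.of_apply]
  rw [← Equiv.prod_comp σ]
  refine Finset.prod_congr rfl fun a _ => ?_
  have : (Pi.mulSingle (σ l) x : Fin k → Matrix (Fin n) (Fin n) ℂ) (σ a) =
      (Pi.mulSingle l x : Fin k → Matrix (Fin n) (Fin n) ℂ) a := by
    simp only [Pi.mulSingle_apply, σ.injective.eq_iff]
  rw [this]
  rfl

lemma commute_diagAction_permTensorMatrix (x : Matrix (Fin n) (Fin n) ℂ)
    (σ : Equiv.Perm (Fin k)) : Commute (diagAction k x) (permTensorMatrix n σ) := by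
  ext i j
  obtain ⟨j, rfl⟩ : ∃ j', j' ∘ σ = j := ⟨j ∘ σ.symm, by ext1; simp⟩
  rw [mul_permTensorMatrix_apply, permTensorMatrix_mul_apply, diagAction_comp_perm]

/-- A linear map commuting with the permutations of the tensor factors, acting by left
multiplication, commutes with left multiplication by any `X` in the commutant of the Lie algebra
action: read column by column, such a map consists of symmetric matrices. -/
lemma map_eq_mul_map_one {X : Matrix (Fin k → Fin n) (Fin k → Fin n) ℂ}
    (hX : ∀ x : Matrix (Fin n) (Fin n) ℂ, Commute X (diagAction k x))
    (p : Matrix (Fin k → Fin n) (Fin k → Fin n) ℂ →ₗ[ℂ]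
      Matrix (Fin k → Fin n) (Fin k → Fin n) ℂ)
    (hp : ∀ σ Y, p (permTensorMatrix n σ * Y) = permTensorMatrix n σ * p Y) :
    p X = X * p 1 := by
  -- `C c d` records how `p` sends column `c` of its argument to column `d` of its value.
  let C : (Fin k → Fin n) → (Fin k → Fin n) → Matrix (Fin k → Fin n) (Fin k → Fin n) ℂ :=
    fun c d => Matrix.of fun a b => p (Matrix.single b c 1) a d
  have hC : ∀ c d, Commute X (C c d) := by
    refine fun c d => commute_of_symmetric hX fun σ a b => ?_
    have hs : permTensorMatrix n σ * Matrix.single (b ∘ σ) c (1 : ℂ) = Matrix.single b c 1 := by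
      ext i j
      rw [permTensorMatrix_mul_apply]
      simp only [Matrix.single_apply, σ.surjective.injective_comp_right.eq_iff]
    exact (permTensorMatrix_mul_apply σ (p (Matrix.single (b ∘ σ) c 1)) a d).symm.trans
      (by rw [← hp, hs]; rfl)
  ext a d
  have hl : p X a d = ∑ c, (C c d * X) a c := by
    conv_lhs => rw [Matrix.matrix_eq_sum_single X]
    simp only [map_sum, Matrix.sum_apply, Matrix.mul_apply]
    rw [Finset.sum_comm]
    refine Finset.sum_congr rfl fun c _ => Finset.sum_congr rfl fun b _ => ?_
    rw [← mul_one (X b c), ← smul_eq_mul, ← Matrix.smul_single, map_smul]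
    simp [C, mul_comm]
  have hr : (X * p 1) a d = ∑ c, (X * C c d) a c := by
    rw [← Matrix.sum_single_one]
    simp only [map_sum, Matrix.sum_apply, Matrix.mul_apply, Finset.mul_sum]
    rw [Finset.sum_comm]
    rfl
  rw [hl, hr]
  exact Finset.sum_congr rfl fun c _ => by rw [(hC c d).eq]

/-- The commutant of the Lie algebra action on the tensor power is spanned by the permutations
of the tensor factors. -/
theorem mem_span_permTensorMatrix {X : Matrix (Fin k → Fin n) (Fin k → Fin n) ℂ}
    (hX : ∀ x : Matrix (Fin n) (Fin n) ℂ, Commute X (diagAction k x)) :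
    X ∈ Submodule.span ℂ (Set.range (permTensorMatrix n (k := k))) := by
  set A := Submodule.span ℂ (Set.range (permTensorMatrix n (k := k)))
  have hmul : ∀ σ, ∀ Y ∈ A, permTensorMatrix n σ * Y ∈ A := by
    intro σ Y hY
    induction hY using Submodule.span_induction with
    | mem Y h =>
      obtain ⟨τ, rfl⟩ := h
      rw [permTensorMatrix_mul]
      exact Submodule.subset_span ⟨_, rfl⟩
    | zero => simp
    | add Y Z _ _ hY hZ => rw [mul_add]; exact A.add_mem hY hZ
    | smul c Y _ hY => rw [mul_smul_comm]; exact A.smul_mem c hY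
  obtain ⟨q, hq⟩ := A.subtype.exists_leftInverse_of_injective A.ker_subtype
  have hq' : ∀ Y (h : Y ∈ A), q Y = ⟨Y, h⟩ := fun Y h => LinearMap.congr_fun hq ⟨Y, h⟩
  -- Averaging the projection `q` over the symmetric group makes it equivariant.
  let p : Matrix (Fin k → Fin n) (Fin k → Fin n) ℂ →ₗ[ℂ]
      Matrix (Fin k → Fin n) (Fin k → Fin n) ℂ :=
    ∑ σ : Equiv.Perm (Fin k), LinearMap.mulLeft ℂ (permTensorMatrix n σ) ∘ₗ A.subtype ∘ₗ q ∘ₗ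
      LinearMap.mulLeft ℂ (permTensorMatrix n σ⁻¹)
  have hpdef : ∀ Y, p Y = ∑ σ : Equiv.Perm (Fin k),
      permTensorMatrix n σ * (q (permTensorMatrix n σ⁻¹ * Y) : Matrix _ _ ℂ) := by
    intro Y
    simp [p, LinearMap.sum_apply]
  have hp : ∀ τ Y, p (permTensorMatrix n τ * Y) = permTensorMatrix n τ * p Y := by
    intro τ Y
    rw [hpdef, hpdef, Finset.mul_sum, ← Equiv.sum_comp (Equiv.mulLeft τ)]
    refine Finset.sum_congr rfl fun σ _ => ?_
    rw [Equiv.coe_mulLeft, ← mul_assoc, ← mul_assoc, permTensorMatrix_mul,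
      permTensorMatrix_mul, mul_inv_rev, inv_mul_cancel_right]
  have hpA : ∀ Y, p Y ∈ A := fun Y => by
    rw [hpdef]
    exact Submodule.sum_mem _ fun σ _ => hmul σ _ (q _).2
  have h1A : (1 : Matrix (Fin k → Fin n) (Fin k → Fin n) ℂ) ∈ A :=
    Submodule.subset_span ⟨1, permTensorMatrix_one⟩
  have hp1 : p 1 = (Fintype.card (Equiv.Perm (Fin k)) : ℂ) • 1 := by
    rw [hpdef, Nat.cast_smul_eq_nsmul, ← Finset.card_univ, ← Finset.sum_const]
    refine Finset.sum_congr rfl fun σ _ => ?_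
    rw [hq' _ (hmul _ _ h1A)]
    simp only [mul_one]
    rw [permTensorMatrix_mul, mul_inv_cancel, permTensorMatrix_one]
  have hcard : (Fintype.card (Equiv.Perm (Fin k)) : ℂ) ≠ 0 :=
    Nat.cast_ne_zero.mpr Fintype.card_ne_zero
  have h := hpA X
  rw [map_eq_mul_map_one hX p hp, hp1, mul_smul_comm, mul_one] at h
  exact (A.smul_mem_iff hcard).mp h

end SchurWeyl

/-! ### Lifting invariants along a quotient map -/

/-- Let `T` be a family of operators closed under adjoints, and `K` a stable subspace. A vector
whose images under `T` lie in `K` is, modulo `K`, annihilated by `T`: the orthogonal complement of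
`K` is stable as well. -/
lemma exists_sub_mem_forall_map_eq_zero {H ι : Type*} [NormedAddCommGroup H]
    [InnerProductSpace ℂ H] [FiniteDimensional ℂ H] (T : ι → H →ₗ[ℂ] H) (adj : ι → ι)
    (hT : ∀ a v w, inner ℂ (T a v) w = inner ℂ v (T (adj a) w)) (K : Submodule ℂ H)
    (hK : ∀ a, ∀ v ∈ K, T a v ∈ K) (m : H) (hm : ∀ a, T a m ∈ K) :
    ∃ v, m - v ∈ K ∧ ∀ a, T a v = 0 := by
  obtain ⟨y, hy, z, hz, rfl⟩ := K.exists_add_mem_mem_orthogonal m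
  refine ⟨z, by simpa using hy, fun a => ?_⟩
  have h1 : T a z ∈ K := by
    have := K.sub_mem (hm a) (hK a y hy)
    rwa [map_add, add_sub_cancel_left] at this
  have h2 : T a z ∈ Kᗮ := by
    rw [Submodule.mem_orthogonal']
    intro w hw
    rw [hT]
    exact (Submodule.mem_orthogonal' K z).mp hz _ (hK _ w hw)
  exact K.isOrtho_orthogonal_right.disjoint.le_bot ⟨h1, h2⟩ |> (Submodule.mem_bot ℂ).mp

open scoped ComplexOrder in
/-- The Hermitian trace form `∑ s, tr (Xₛᴴ Yₛ)` on a finite family of matrix spaces. -/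
@[reducible] def traceInnerCore {S : Type*} [Fintype S] (N : S → Type*) [∀ s, Fintype (N s)] :
    InnerProductSpace.Core ℂ (∀ s, Matrix (N s) (N s) ℂ) where
  inner X Y := ∑ s, ((X s).conjTranspose * Y s).trace
  conj_inner_symm X Y := by
    simp only [map_sum, starRingEnd_apply, ← Matrix.trace_conjTranspose,
      Matrix.conjTranspose_mul, Matrix.conjTranspose_conjTranspose]
  re_inner_nonneg X := by
    rw [map_sum]
    exact Finset.sum_nonneg fun s _ => (Complex.le_def.mp
      (Matrix.posSemidef_conjTranspose_mul_self (X s)).trace_nonneg).1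
  add_left X Y Z := by
    simp [Matrix.add_mul, Finset.sum_add_distrib]
  smul_left X Y r := by
    simp [Finset.mul_sum]
  definite X hX := by
    have h := (Finset.sum_eq_zero_iff_of_nonneg fun s _ =>
      (Matrix.posSemidef_conjTranspose_mul_self (X s)).trace_nonneg).mp hX
    exact funext fun s =>
      Matrix.trace_conjTranspose_mul_self_eq_zero_iff.mp (h s (Finset.mem_univ s))

/-- If a family of commutator operators, closed under conjugate transposition, acts on a finite
product of matrix spaces, then every vector that is invariant modulo a stable subspace `K` agrees
modulo `K` with an invariant vector. -/
lemma exists_sub_mem_forall_commute {S ι : Type*} [Fintype S] (N : S → Type*)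
    [∀ s, Fintype (N s)] (D : ι → ∀ s, Matrix (N s) (N s) ℂ) (adj : ι → ι)
    (hD : ∀ a s, D (adj a) s = (D a s).conjTranspose)
    (K : Submodule ℂ (∀ s, Matrix (N s) (N s) ℂ))
    (hK : ∀ a, ∀ X ∈ K, D a * X - X * D a ∈ K) (X : ∀ s, Matrix (N s) (N s) ℂ)
    (hX : ∀ a, D a * X - X * D a ∈ K) :
    ∃ Y, X - Y ∈ K ∧ ∀ a s, Commute (Y s) (D a s) := by
  let core := traceInnerCore N
  let : NormedAddCommGroup (∀ s, Matrix (N s) (N s) ℂ) := core.toNormedAddCommGroup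
  let : InnerProductSpace ℂ (∀ s, Matrix (N s) (N s) ℂ) := InnerProductSpace.ofCore core.toCore
  have hinner : ∀ X Y : ∀ s, Matrix (N s) (N s) ℂ,
    inner ℂ X Y = ∑ s, ((X s).conjTranspose * Y s).trace := fun _ _ => rfl
  obtain ⟨Y, hY, h0⟩ := exists_sub_mem_forall_map_eq_zero
    (fun a => LinearMap.mulLeft ℂ (D a) - LinearMap.mulRight ℂ (D a)) adj
    (fun a v w => by
      rw [hinner, hinner]
      refine Finset.sum_congr rfl fun s _ => ?_
      simp only [LinearMap.sub_apply, LinearMap.mulLeft_apply, LinearMap.mulRight_apply,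
        Pi.sub_apply, Pi.mul_apply, hD, Matrix.conjTranspose_sub, Matrix.conjTranspose_mul,
        Matrix.sub_mul, Matrix.mul_sub, Matrix.trace_sub, Matrix.mul_assoc]
      rw [Matrix.trace_mul_comm (D a s).conjTranspose]
      simp only [Matrix.mul_assoc])
    K hK X hX
  exact ⟨Y, hY, fun a s => (sub_eq_zero.mp (congrFun (h0 a) s)).symm⟩

/-! ### Ordered products span the enveloping algebra -/

section Spanning

attribute [local instance] LieRing.ofAssociativeRing

variable {𝔤 : Type*} [LieRing 𝔤] [LieAlgebra ℂ 𝔤]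

lemma currentElt_mul_sub (x y : 𝔤) (P Q : Polynomial ℂ) :
    currentElt x P * currentElt y Q - currentElt y Q * currentElt x P =
      currentElt ⁅x, y⁆ (P * Q) := by
  have h := (UniversalEnvelopingAlgebra.ι ℂ (L := CurrentAlgebra 𝔤)).map_lie
    (P ⊗ₜ[ℂ] x) (Q ⊗ₜ[ℂ] y)
  rw [LieAlgebra.ExtendScalars.bracket_tmul] at h
  exact h.symm

/-- The linear map `x ↦ x(t ^ m)` from `𝔤` to the enveloping algebra. -/
def currentLinear (𝔤 : Type*) [LieRing 𝔤] [LieAlgebra ℂ 𝔤] (m : ℕ) : 𝔤 →ₗ[ℂ] UCurrent 𝔤 :=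
  (UniversalEnvelopingAlgebra.ι ℂ : CurrentAlgebra 𝔤 →ₗ⁅ℂ⁆ UCurrent 𝔤).toLinearMap ∘ₗ
    TensorProduct.mk ℂ (Polynomial ℂ) 𝔤 (Polynomial.X ^ m)

lemma currentLinear_apply (m : ℕ) (x : 𝔤) :
    currentLinear 𝔤 m x = currentElt x (Polynomial.X ^ m) := rfl

/-- The product of the `x(t ^ a)` over a list of pairs `(x, a)`. -/
def currentListProd (L : List (𝔤 × ℕ)) : UCurrent 𝔤 :=
  (L.map fun p => currentLinear 𝔤 p.2 p.1).prod

/-- The span of the products of fewer than `d` elements `x(t ^ a)`. The inequality is strict so that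
the error made by reordering a product of length `d` lies in the `d`-th step. -/
def lengthFiltration (𝔤 : Type*) [LieRing 𝔤] [LieAlgebra ℂ 𝔤] (d : ℕ) :
    Submodule ℂ (UCurrent 𝔤) :=
  Submodule.span ℂ {u | ∃ L : List (𝔤 × ℕ), L.length < d ∧ u = currentListProd L}

lemma mul_mem_lengthFiltration (p : 𝔤 × ℕ) {d : ℕ} {u : UCurrent 𝔤}
    (hu : u ∈ lengthFiltration 𝔤 d) :
    currentLinear 𝔤 p.2 p.1 * u ∈ lengthFiltration 𝔤 (d + 1) := by
  unfold lengthFiltration at hu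
  induction hu using Submodule.span_induction with
  | mem u h =>
    obtain ⟨L, hL, rfl⟩ := h
    exact Submodule.subset_span ⟨p :: L, by simpa using hL, by simp [currentListProd]⟩
  | zero => simp
  | add u v _ _ hu hv => rw [mul_add]; exact Submodule.add_mem _ hu hv
  | smul c u _ hu => rw [mul_smul_comm]; exact Submodule.smul_mem _ c hu

/-- Permuting the factors changes a product only by shorter products. -/
lemma currentListProd_sub_mem_of_perm {L L' : List (𝔤 × ℕ)} (h : L.Perm L') :
    currentListProd L - currentListProd L' ∈ lengthFiltration 𝔤 L.length := by
  induction h with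
  | nil => simp
  | cons p h ih =>
    have := mul_mem_lengthFiltration p ih
    rw [mul_sub] at this
    simpa [currentListProd] using this
  | swap p q L =>
    refine Submodule.subset_span ⟨(⁅q.1, p.1⁆, q.2 + p.2) :: L, by simp, ?_⟩
    simp only [currentListProd, List.map_cons, List.prod_cons, currentLinear_apply]
    rw [pow_add, ← currentElt_mul_sub, sub_mul, mul_assoc, mul_assoc]
  | trans h₁ _ ih₁ ih₂ =>
    rw [← h₁.length_eq] at ih₂
    simpa using Submodule.add_mem _ ih₁ ih₂

/-- The span of the products of elements `x(t ^ a)` with weakly increasing exponents. -/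
def sortedSpan (𝔤 : Type*) [LieRing 𝔤] [LieAlgebra ℂ 𝔤] : Submodule ℂ (UCurrent 𝔤) :=
  Submodule.span ℂ {u | ∃ (k : ℕ) (m : Fin k → ℕ) (f : Fin k → 𝔤), Monotone m ∧
    u = (List.ofFn fun l => currentLinear 𝔤 (m l) (f l)).prod}

lemma currentListProd_mem_sortedSpan (L : List (𝔤 × ℕ)) :
    currentListProd L ∈ sortedSpan 𝔤 := by
  induction hd : L.length using Nat.strong_induction_on generalizing L with
  | _ d ih =>
    subst hd
    set r : 𝔤 × ℕ → 𝔤 × ℕ → Prop := fun p q => p.2 ≤ q.2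
    have : DecidableRel r := fun p q => Nat.decLe p.2 q.2
    have : Std.Total r := ⟨fun p q => le_total p.2 q.2⟩
    have : IsTrans (𝔤 × ℕ) r := ⟨fun _ _ _ h₁ h₂ => le_trans h₁ h₂⟩
    have hsort : currentListProd (L.insertionSort r) ∈ sortedSpan 𝔤 := by
      set M := L.insertionSort r
      refine Submodule.subset_span ⟨M.length, fun l => (M.get l).2, fun l => (M.get l).1, ?_, ?_⟩
      · have hp : M.Pairwise r := List.pairwise_insertionSort r L
        rw [← List.ofFn_get M, List.pairwise_ofFn] at hp
        intro i j hij
        rcases hij.eq_or_lt with rfl | h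
        · exact le_rfl
        · exact hp h
      · rw [currentListProd]
        conv_lhs => rw [← List.ofFn_get M, List.map_ofFn]
        rfl
    -- Shorter products are covered by induction, so sorting `L` is harmless.
    have hle : lengthFiltration 𝔤 L.length ≤ sortedSpan 𝔤 := by
      refine Submodule.span_le.mpr ?_
      rintro _ ⟨L', hL', rfl⟩
      exact ih _ hL' L' rfl
    have h := hle (currentListProd_sub_mem_of_perm (List.perm_insertionSort r L).symm)
    simpa using Submodule.add_mem _ h hsort

lemma UCurrent.induction_subalgebra (S : Subalgebra ℂ (UCurrent 𝔤))
    (hS : ∀ m x, currentLinear 𝔤 m x ∈ S) (u : UCurrent 𝔤) : u ∈ S := by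
  obtain ⟨t, rfl⟩ : ∃ t, UniversalEnvelopingAlgebra.mkAlgHom ℂ (CurrentAlgebra 𝔤) t = u :=
    RingCon.mkₐ_surjective _ u
  induction t using TensorAlgebra.induction with
  | algebraMap r => rw [AlgHom.commutes]; exact S.algebraMap_mem r
  | mul a b ha hb => rw [map_mul]; exact S.mul_mem ha hb
  | add a b ha hb => rw [map_add]; exact S.add_mem ha hb
  | ι w =>
    rw [← UniversalEnvelopingAlgebra.ι_apply]
    induction w using TensorProduct.induction_on with
    | zero => rw [map_zero]; exact S.zero_mem
    | add v w hv hw => rw [map_add]; exact S.add_mem hv hw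
    | tmul P x =>
      induction P using Polynomial.induction_on' with
      | add P Q hP hQ => rw [TensorProduct.add_tmul, map_add]; exact S.add_mem hP hQ
      | monomial m c =>
        rw [← Polynomial.C_mul_X_pow_eq_monomial, ← Polynomial.smul_eq_C_mul,
          ← TensorProduct.smul_tmul', map_smul]
        exact S.smul_mem (hS m x) c

/-- The spanning half of the Poincaré–Birkhoff–Witt theorem. -/
theorem sortedSpan_eq_top : sortedSpan 𝔤 = ⊤ := by
  refine eq_top_iff.mpr fun u _ => ?_
  set G : Set (UCurrent 𝔤) := Set.range fun p : 𝔤 × ℕ => currentLinear 𝔤 p.2 p.1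
  have hu : u ∈ Subalgebra.toSubmodule (Algebra.adjoin ℂ G) :=
    UCurrent.induction_subalgebra (Algebra.adjoin ℂ G)
      (fun m x => Algebra.subset_adjoin (Set.mem_range_self (x, m))) u
  rw [Algebra.adjoin_eq_span] at hu
  refine Submodule.span_le.mpr (fun v hv => ?_) hu
  suffices ∃ L : List (𝔤 × ℕ), v = currentListProd L by
    obtain ⟨L, rfl⟩ := this
    exact currentListProd_mem_sortedSpan L
  induction hv using Submonoid.closure_induction with
  | mem v h =>
    obtain ⟨p, rfl⟩ := h
    exact ⟨[p], by simp [currentListProd]⟩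
  | one => exact ⟨[], by simp [currentListProd]⟩
  | mul v w _ _ hv hw =>
    obtain ⟨L, rfl⟩ := hv
    obtain ⟨M, rfl⟩ := hw
    exact ⟨L ++ M, by simp [currentListProd]⟩

end Spanning

/-! ### Tensors as elements of the enveloping algebra -/

/-- The Leibniz rule for a commutator with a product. -/
lemma mul_prod_ofFn_sub {A : Type*} [Ring A] (c : A) {k : ℕ} (a : Fin k → A) :
    c * (List.ofFn a).prod - (List.ofFn a).prod * c =
      ∑ l, (List.ofFn (Function.update a l (c * a l - a l * c))).prod := by
  induction k with
  | zero => simp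
  | succ k ih =>
    have h := ih fun l => a l.succ
    -- Updating the head leaves the tail alone, and updating the tail commutes with restriction.
    have h0 : ∀ b l, Function.update a 0 b (Fin.succ l) = a l.succ := fun b l =>
      Function.update_of_ne (Fin.succ_ne_zero l) _ _
    have hs : ∀ b l, (fun l' : Fin k => Function.update a (Fin.succ l) b l'.succ) =
        Function.update (fun l' => a l'.succ) l b := fun b l => by
      ext1 l'
      simp [Function.update_apply]
    rw [Fin.sum_univ_succ]
    simp only [List.ofFn_succ, List.prod_cons, Function.update_self, h0, hs]
    simp only [Function.update_of_ne (Fin.succ_ne_zero _).symm, ← Finset.mul_sum, ← h]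
    noncomm_ring

section Evaluation

attribute [local instance] LieRing.ofAssociativeRing

variable {n k : ℕ}

/-- The multilinear map `(x₁, …, xₖ) ↦ x₁(t ^ m₁) ⋯ xₖ(t ^ mₖ)`. -/
def wordMap (n : ℕ) (m : Fin k → ℕ) :
    MultilinearMap ℂ (fun _ : Fin k => GlLie n) (UCurrent (GlLie n)) :=
  (MultilinearMap.mkPiAlgebraFin ℂ k (UCurrent (GlLie n))).compLinearMap
    fun l => currentLinear (GlLie n) (m l)

lemma wordMap_apply (m : Fin k → ℕ) (f : Fin k → GlLie n) :
    wordMap n m f = (List.ofFn fun l => currentElt (f l) (Polynomial.X ^ m l)).prod := by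
  simp only [wordMap, MultilinearMap.compLinearMap_apply, MultilinearMap.mkPiAlgebraFin_apply,
    currentLinear_apply]

/-- The linear map sending the matrix of `x₁ ⊗ ⋯ ⊗ xₖ` on the tensor power to
`x₁(t ^ m₁) ⋯ xₖ(t ^ mₖ)`. -/
def evalTensor (n : ℕ) (m : Fin k → ℕ) :
    Matrix (Fin k → Fin n) (Fin k → Fin n) ℂ →ₗ[ℂ] UCurrent (GlLie n) :=
  ∑ i, ∑ j, (Matrix.entryLinearMap ℂ ℂ i j).smulRight
    (wordMap n m fun l => Matrix.single (i l) (j l) (1 : ℂ))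

lemma evalTensor_apply (m : Fin k → ℕ) (X : Matrix (Fin k → Fin n) (Fin k → Fin n) ℂ) :
    evalTensor n m X =
      ∑ i, ∑ j, X i j • wordMap n m fun l => Matrix.single (i l) (j l) (1 : ℂ) := by
  simp [evalTensor, LinearMap.sum_apply]

lemma evalTensor_tensorMatrix (m : Fin k → ℕ) (f : Fin k → GlLie n) :
    evalTensor n m (tensorMatrix f) = wordMap n m f := by
  have hf : f = fun l => ∑ p : Fin n × Fin n,
      f l p.1 p.2 • (Matrix.single p.1 p.2 (1 : ℂ) : GlLie n) := by
    ext1 l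
    conv_lhs => rw [Matrix.matrix_eq_sum_single (f l)]
    rw [Fintype.sum_prod_type]
    simp only [Matrix.smul_single, smul_eq_mul, mul_one]
  conv_rhs => rw [hf]
  rw [MultilinearMap.map_sum, evalTensor_apply,
    ← Equiv.sum_comp (Equiv.arrowProdEquivProdArrow (Fin k) (fun _ => Fin n) fun _ => Fin n).symm,
    Fintype.sum_prod_type]
  refine Finset.sum_congr rfl fun i _ => Finset.sum_congr rfl fun j _ => ?_
  rw [MultilinearMap.map_smul_univ]
  rfl

lemma evalTensor_permTensorMatrix (m : Fin k → ℕ) (σ : Equiv.Perm (Fin k)) :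
    evalTensor n m (permTensorMatrix n σ) = permInvariant n σ m := by
  rw [evalTensor_apply, permInvariant]
  simp [permTensorMatrix, wordMap_apply]

/-- `evalTensor` intertwines the adjoint action of `𝔤` with the action on endomorphisms of the
tensor power by commutators. -/
lemma currentElt_commutator_evalTensor (x : GlLie n) (m : Fin k → ℕ)
    (X : Matrix (Fin k → Fin n) (Fin k → Fin n) ℂ) :
    currentElt x 1 * evalTensor n m X - evalTensor n m X * currentElt x 1 =
      evalTensor n m (diagAction k x * X - X * diagAction k x) := by
  have htensor : ∀ f : Fin k → GlLie n,
      currentElt x 1 * wordMap n m f - wordMap n m f * currentElt x 1 =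
        evalTensor n m (diagAction k x * tensorMatrix f - tensorMatrix f * diagAction k x) := by
    intro f
    rw [diagAction_commutator_tensorMatrix, map_sum, wordMap_apply, mul_prod_ofFn_sub]
    refine Finset.sum_congr rfl fun l _ => ?_
    rw [map_sub, evalTensor_tensorMatrix, evalTensor_tensorMatrix,
      ← MultilinearMap.map_update_sub, wordMap_apply, currentElt_mul_sub, one_mul]
    congr 2
    ext1 l'
    rcases eq_or_ne l' l with rfl | h
    · simp only [Function.update_self]
      rfl
    · simp only [Function.update_of_ne h]
  have hlin : (LinearMap.mulLeft ℂ (currentElt x 1) - LinearMap.mulRight ℂ (currentElt x 1)) ∘ₗ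
      evalTensor n m = evalTensor n m ∘ₗ
        (LinearMap.mulLeft ℂ (diagAction k x) - LinearMap.mulRight ℂ (diagAction k x)) := by
    refine Matrix.ext_linearMap ℂ fun i j => LinearMap.ext_ring ?_
    have h := htensor fun l => Matrix.single (i l) (j l) (1 : ℂ)
    rw [tensorMatrix_single] at h
    rw [← evalTensor_tensorMatrix, tensorMatrix_single] at h
    simpa using h
  exact LinearMap.congr_fun hlin X

end Evaluation

/-! ### Invariants of the enveloping algebra -/

lemma permInvariant_mem_currentInvariants (n : ℕ) {k : ℕ} (σ : Equiv.Perm (Fin k))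
    (m : Fin k → ℕ) : permInvariant n σ m ∈ currentInvariants (GlLie n) := by
  intro x
  rw [← evalTensor_permTensorMatrix, currentElt_commutator_evalTensor,
    (commute_diagAction_permTensorMatrix x σ).eq, sub_self, map_zero]

/-- A weakly increasing tuple of exponents of arbitrary length. -/
abbrev ExponentTuple : Type := Σ k : ℕ, {m : Fin k → ℕ // Monotone m}

lemma iSup_range_evalTensor (n : ℕ) :
    ⨆ s : ExponentTuple, LinearMap.range (evalTensor n s.2.1) = ⊤ := by
  rw [eq_top_iff, ← sortedSpan_eq_top, sortedSpan, Submodule.span_le]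
  rintro _ ⟨k, m, f, hm, rfl⟩
  refine Submodule.mem_iSup_of_mem (⟨k, m, hm⟩ : ExponentTuple) ⟨tensorMatrix f, ?_⟩
  rw [evalTensor_tensorMatrix, wordMap_apply]
  rfl

/-- Every element of the enveloping algebra is a finite sum of values of `evalTensor`. -/
lemma exists_eq_sum_evalTensor {n : ℕ} (u : UCurrent (GlLie n)) :
    ∃ (S : Finset ExponentTuple)
      (X : ∀ s : S, Matrix (Fin s.1.1 → Fin n) (Fin s.1.1 → Fin n) ℂ),
      u = ∑ s : S, evalTensor n s.1.2.1 (X s) := by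
  have hu : u ∈ ⨆ s : ExponentTuple, LinearMap.range (evalTensor n s.2.1) := by
    rw [iSup_range_evalTensor]
    trivial
  obtain ⟨f, hf, rfl⟩ := (Submodule.mem_iSup_iff_exists_finsupp _ _).mp hu
  choose X hX using hf
  refine ⟨f.support, fun s => X s.1, ?_⟩
  rw [Finsupp.sum, ← Finset.sum_coe_sort]
  exact Finset.sum_congr rfl fun s _ => (hX s.1).symm

/-- Lifting an invariant to commuting matrices reduces its description to Schur–Weyl duality. -/
theorem mem_span_permInvariant {n : ℕ} {u : UCurrent (GlLie n)}
    (hu : u ∈ currentInvariants (GlLie n)) :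
    u ∈ Submodule.span ℂ {u : UCurrent (GlLie n) |
      ∃ (k : ℕ) (m : Fin k → ℕ) (σ : Equiv.Perm (Fin k)),
        Monotone m ∧ u = permInvariant n σ m} := by
  obtain ⟨S, X, rfl⟩ := exists_eq_sum_evalTensor u
  -- The kernel of `Φ` is stable under the action, and `X` is invariant modulo it.
  let Φ : (∀ s : S, Matrix (Fin s.1.1 → Fin n) (Fin s.1.1 → Fin n) ℂ) →ₗ[ℂ]
      UCurrent (GlLie n) := ∑ s : S, evalTensor n s.1.2.1 ∘ₗ LinearMap.proj s
  have hΦ : ∀ Y, Φ Y = ∑ s : S, evalTensor n s.1.2.1 (Y s) := fun Y => by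
    simp [Φ, LinearMap.sum_apply]
  let D : GlLie n → ∀ s : S, Matrix (Fin s.1.1 → Fin n) (Fin s.1.1 → Fin n) ℂ :=
    fun x s => diagAction s.1.1 x
  have hcomm : ∀ x Y, Φ (D x * Y - Y * D x) = currentElt x 1 * Φ Y - Φ Y * currentElt x 1 := by
    intro x Y
    rw [hΦ, hΦ, Finset.mul_sum, Finset.sum_mul, ← Finset.sum_sub_distrib]
    exact Finset.sum_congr rfl fun s _ => (currentElt_commutator_evalTensor x _ _).symm
  obtain ⟨Y, hY, hD⟩ := exists_sub_mem_forall_commute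
    (fun s : S => Fin s.1.1 → Fin n) D Matrix.conjTranspose
    (fun x s => (diagAction_conjTranspose x).symm) (LinearMap.ker Φ)
    (fun x Z hZ => by
      rw [LinearMap.mem_ker] at hZ ⊢
      rw [hcomm, hZ, mul_zero, zero_mul, sub_zero])
    X (fun x => by
      rw [LinearMap.mem_ker, hcomm, hΦ]
      exact hu x)
  rw [LinearMap.mem_ker, map_sub, sub_eq_zero, hΦ, hΦ] at hY
  rw [hY]
  refine Submodule.sum_mem _ fun s _ => ?_
  have hs := Submodule.mem_map_of_mem (f := evalTensor n s.1.2.1)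
    (mem_span_permTensorMatrix fun x => hD x s)
  rw [Submodule.map_span] at hs
  refine Submodule.span_mono ?_ hs
  rintro _ ⟨_, ⟨σ, rfl⟩, rfl⟩
  exact ⟨_, s.1.2.1, σ, s.1.2.2, evalTensor_permTensorMatrix _ σ⟩

theorem mainTheorem4 (n : ℕ) :
    Submodule.span ℂ
        {u : UCurrent (GlLie n) |
          ∃ (k : ℕ) (m : Fin k → ℕ) (σ : Equiv.Perm (Fin k)),
            Monotone m ∧ u = permInvariant n σ m} =
      Subalgebra.toSubmodule (currentInvariants (GlLie n)) := by
  refine le_antisymm (Submodule.span_le.mpr ?_) fun u hu => mem_span_permInvariant hu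
  rintro _ ⟨k, m, σ, -, rfl⟩
  exact permInvariant_mem_currentInvariants n σ m

end
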